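/- Let $\widehat{\mathbf n}=\{n_k\}_{k\ge 1}$ be a sequence of integers with $n_k>1$ for all $k$, and put $N_k=n_1n_2\cdots n_k$. Let $\mathfrak S_N$ be the group of permutations of $\{0,1,\dots,N-1\}$. For $k\le j$ embed $\mathfrak S_{N_k}$ into $\mathfrak S_{N_j}$ block-diagonally by $\sigma\mapsto\big(x_1+N_kx_2\mapsto \sigma(x_1)+N_kx_2\big)$, where $0\le x_1<N_k$ and $0\le x_2<N_j/N_k$, and let $\mathfrak S_{\widehat{\mathbf n}}=\varinjlim\mathfrak S_{N_k}=\bigcup_k\mathfrak S_{N_k}$ be the inductive limit along these embeddings. An indecomposable character of a group $G$ is a function $\chi:G\to\mathbb C$ such that (a) $\chi(gh)=\chi(hg)$ for all $g,h\in G$; (b) $\chi$ is positive definite, i.e. for all $g_1,\dots,g_m\in G$ the matrix $[\chi(g_ig_j^{-1})]$ is Hermitian and positive semidefinite; (c) $\chi(1)=1$; (d) $\chi$ is not a sum of two linearly independent functions satisfying (a) and (b). For a partition $\lambda$ of $N$ (written $\lambda\vdash N$) let $\mathcal R_\lambda$ be the irreducible complex representation of $\mathfrak S_N$ corresponding to $\lambda$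 (the Specht module of shape $\lambda$), and let $\chi_\lambda(\sigma)=\operatorname{Tr}\mathcal R_\lambda(\sigma)/\operatorname{Tr}\mathcal R_\lambda(1)$ be its normalized character. **Proposition.** For every indecomposable character $\chi$ of $\mathfrak S_{\widehat{\mathbf n}}$ there are a strictly increasing sequence $\{k(l)\}_{l\ge1}$ of positive integers and partitions $\lambda^{(k(l))}\vdash N_{k(l)}$ such that $$\lim_{l\to\infty}\chi_{\lambda^{(k(l))}}(g)=\chi(g)\qquad\text{for all } g\in\mathfrak S_{\widehat{\mathbf n}},$$ where $\chi_{\lambda^{(k(l))}}(g)$ is defined as soon as $g\in\mathfrak S_{N_{k(l)}}$, hence for all sufficiently large $l$. -/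

import Mathlib

open Filter Topology
open scoped ComplexOrder

noncomputable section

/-! ### Characters of a group -/

/-- A function `φ : G → ℂ` is central if `φ (g h) = φ (h g)` for all `g`, `h`. -/
def IsCentralFun {G : Type*} [Group G] (φ : G → ℂ) : Prop :=
  ∀ g h : G, φ (g * h) = φ (h * g)

/-- A function `φ : G → ℂ` is positive definite if for all `g₁, …, g_m` in `G` the matrix
`[φ (g_i g_j⁻¹)]` is Hermitian and positive semidefinite. -/
def IsPosDefFun {G : Type*} [Group G] (φ : G → ℂ) : Prop :=
  ∀ (m : ℕ) (g : Fin m → G), (Matrix.of fun i j => φ (g i * (g j)⁻¹)).PosSemidef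

/-- A (normalized) character of `G`: central, positive definite, equal to `1` at the identity. -/
structure IsNormalizedCharacter {G : Type*} [Group G] (χ : G → ℂ) : Prop where
  central : IsCentralFun χ
  posDef : IsPosDefFun χ
  map_one : χ 1 = 1

/-- An indecomposable character: a normalized character which is not a sum of two linearly
independent central positive definite functions. -/
structure IsIndecomposableCharacter {G : Type*} [Group G] (χ : G → ℂ) : Prop
    extends IsNormalizedCharacter χ where
  indecomposable : ¬ ∃ φ ψ : G → ℂ,
    IsCentralFun φ ∧ IsPosDefFun φ ∧ IsCentralFun ψ ∧ IsPosDefFun ψ ∧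
      LinearIndependent ℂ ![φ, ψ] ∧ χ = φ + ψ

/-! ### The inductive limit of symmetric groups -/

/-- For `N ∣ M`, the bijection `(x₂, x₁) ↦ x₁ + N * x₂`. -/
def blockEquiv {N M : ℕ} (h : N ∣ M) : Fin (M / N) × Fin N ≃ Fin M :=
  finProdFinEquiv.trans (finCongr (Nat.div_mul_cancel h))

/-- The block diagonal embedding `𝔖_N → 𝔖_M` for `N ∣ M`:
`x₁ + N * x₂ ↦ σ x₁ + N * x₂`. -/
def blockEmbedding {N M : ℕ} (h : N ∣ M) : Equiv.Perm (Fin N) →* Equiv.Perm (Fin M) where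
  toFun σ := (blockEquiv h).permCongr (Equiv.prodCongr (Equiv.refl _) σ)
  map_one' := by ext x; simp [Equiv.permCongr_apply]
  map_mul' σ τ := by ext x; simp [Equiv.permCongr_apply, Prod.map_map, Function.comp_def]

theorem blockEmbedding_apply_val {N M : ℕ} (h : N ∣ M) (σ : Equiv.Perm (Fin N)) (x : Fin M)
    (hx : (x : ℕ) % N < N) :
    (blockEmbedding h σ x : ℕ) = (σ ⟨(x : ℕ) % N, hx⟩ : ℕ) + N * ((x : ℕ) / N) := rfl

/-- The sizes `N_1 = n_1`, `N_2 = n_1 n_2`, …; the sequence `n_1, n_2, …` is written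
`n 0, n 1, …` and `N_1, N_2, …` is `levelSize n 0, levelSize n 1, …`. -/
def levelSize (n : ℕ → ℕ) (k : ℕ) : ℕ := ∏ i ∈ Finset.range (k + 1), n i

theorem levelSize_dvd (n : ℕ → ℕ) {k j : ℕ} (h : k ≤ j) : levelSize n k ∣ levelSize n j :=
  Finset.prod_dvd_prod_of_subset _ _ _ (Finset.range_mono (by omega))

/-- The embeddings `𝔖_{N_k} → 𝔖_{N_j}`, `k ≤ j`. -/
def levelMap (n : ℕ → ℕ) (k j : ℕ) (h : k ≤ j) :
    Equiv.Perm (Fin (levelSize n k)) →* Equiv.Perm (Fin (levelSize n j)) :=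
  blockEmbedding (levelSize_dvd n h)

theorem mod_lt_of_fin_dvd {N M : ℕ} (h : N ∣ M) (x : Fin M) : (x : ℕ) % N < N :=
  Nat.mod_lt _ (Nat.pos_of_dvd_of_pos h (Nat.pos_of_ne_zero (by rintro rfl; exact x.elim0)))

instance levelDirectedSystem (n : ℕ → ℕ) :
    DirectedSystem (fun k => Equiv.Perm (Fin (levelSize n k)))
      (fun k j h => levelMap n k j h) where
  map_self k σ := by
    ext x
    have h1 := Nat.mod_eq_of_lt x.2
    have h2 := Nat.div_eq_of_lt x.2
    rw [levelMap, blockEmbedding_apply_val _ _ _ (mod_lt_of_fin_dvd dvd_rfl x)]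
    simp [h1, h2]
  map_map l k j hjk hkl σ := by
    ext x
    have hd := levelSize_dvd n hjk
    have hd' := levelSize_dvd n hkl
    have hx := mod_lt_of_fin_dvd hd' x
    have hx' := mod_lt_of_fin_dvd hd ⟨_, hx⟩
    have hx'' := mod_lt_of_fin_dvd (hd.trans hd') x
    simp only [levelMap]
    rw [blockEmbedding_apply_val _ _ _ hx, blockEmbedding_apply_val _ _ _ hx',
      blockEmbedding_apply_val _ _ _ hx'']
    have e1 : (x : ℕ) % levelSize n k % levelSize n j = (x : ℕ) % levelSize n j :=
      Nat.mod_mod_of_dvd _ hd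
    obtain ⟨c, hc⟩ := hd
    have hpos : 0 < levelSize n j := lt_of_le_of_lt (Nat.zero_le _) hx''
    have e2 : (x : ℕ) % levelSize n k / levelSize n j + c * ((x : ℕ) / levelSize n k)
        = (x : ℕ) / levelSize n j := by
      rw [hc, Nat.mod_mul_right_div_self, ← Nat.div_div_eq_div_mul]
      exact Nat.mod_add_div _ _
    simp only [e1]
    have e3 : levelSize n k * ((x : ℕ) / levelSize n k)
        = levelSize n j * (c * ((x : ℕ) / levelSize n k)) := by
      conv_lhs => rw [show levelSize n k * ((x : ℕ) / levelSize n k)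
        = levelSize n j * c * ((x : ℕ) / levelSize n k) from by rw [← hc]]
      rw [mul_assoc]
    rw [add_assoc, ← e2, mul_add, e3]

/-- The group `𝔖_n̂`, the inductive limit of `𝔖_{N_1} → 𝔖_{N_2} → ⋯` along the block diagonal
embeddings. -/
abbrev LimitSym (n : ℕ → ℕ) : Type :=
  DirectLimit (fun k => Equiv.Perm (Fin (levelSize n k))) (levelMap n)

/-- The canonical map from the `k`-th symmetric group to the inductive limit. -/
def toLimitSym (n : ℕ → ℕ) (k : ℕ) : Equiv.Perm (Fin (levelSize n k)) →* LimitSym n where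
  toFun σ := ⟦⟨k, σ⟩⟧
  map_one' := (DirectLimit.one_def (f := levelMap n) k).symm
  map_mul' σ τ := (DirectLimit.mul_def (f := levelMap n) k σ τ).symm

theorem blockEmbedding_injective {N M : ℕ} (h : N ∣ M) (hM : 0 < M) :
    Function.Injective (blockEmbedding h) := by
  intro σ τ hst
  ext x
  have hNM : N ≤ M := Nat.le_of_dvd hM h
  have h1 := Nat.mod_eq_of_lt x.2
  have := congrArg Fin.val (congrArg (fun p => p (Fin.castLE hNM x)) hst)
  rw [blockEmbedding_apply_val _ _ _ (mod_lt_of_fin_dvd h _),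
    blockEmbedding_apply_val _ _ _ (mod_lt_of_fin_dvd h _)] at this
  simpa [h1] using this

/-- The symmetric groups are subgroups of the inductive limit. -/
theorem toLimitSym_injective (n : ℕ → ℕ) (hn : ∀ i, 1 < n i) (k : ℕ) :
    Function.Injective (toLimitSym n k) :=
  fun _ _ h => DirectLimit.mk_injective (F := fun k => Equiv.Perm (Fin (levelSize n k))) (levelMap n)
    (fun _ _ h => blockEmbedding_injective (levelSize_dvd n h)
      (Finset.prod_pos fun i _ => (zero_lt_one.trans (hn i)))) k h

/-! ### The irreducible representations of symmetric groups (Specht modules) -/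

/-- A tableau of shape `lam`: a bijective filling of the cells of `lam` with `0, …, N - 1`,
given by the map that sends an entry to its cell. The cell `(i, j)` is in row `i`, column `j`. -/
abbrev Tableau (N : ℕ) (lam : YoungDiagram) : Type := Fin N ≃ lam.cells

/-- The column stabilizer of a tableau. -/
def columnStabilizer {N : ℕ} {lam : YoungDiagram} (t : Tableau N lam) :
    Finset (Equiv.Perm (Fin N)) :=
  {π | ∀ x, (t (π x)).1.2 = (t x).1.2}

/-- The tabloid (row equivalence class) of a tableau, encoded as the function that sends each entry
to the index of its row. -/
def tabloid {N : ℕ} {lam : YoungDiagram} (t : Tableau N lam) : Fin N → ℕ :=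
  fun x => (t x).1.1

/-- The permutation representation of `𝔖_N` on the complex vector space with basis the functions
`Fin N → ℕ`, where `σ` sends the basis vector `f` to `f ∘ σ⁻¹`. -/
def rowPermRep (N : ℕ) : Representation ℂ (Equiv.Perm (Fin N)) ((Fin N → ℕ) →₀ ℂ) where
  toFun σ := Finsupp.lmapDomain ℂ ℂ fun f : Fin N → ℕ => f ∘ ⇑σ⁻¹
  map_one' := by
    refine Finsupp.lhom_ext fun f a => ?_
    simp [Finsupp.mapDomain_single]
  map_mul' σ τ := by
    refine Finsupp.lhom_ext fun f a => ?_
    simp [Finsupp.mapDomain_single, Function.comp_assoc]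

/-- The polytabloid of a tableau `t`: the sum of `sgn π` times the tabloid of `π t` over the column
stabilizer of `t`. -/
def polytabloid {N : ℕ} {lam : YoungDiagram} (t : Tableau N lam) : (Fin N → ℕ) →₀ ℂ :=
  ∑ π ∈ columnStabilizer t,
    ((Equiv.Perm.sign π : ℤ) : ℂ) • Finsupp.single (tabloid t ∘ ⇑π⁻¹) (1 : ℂ)

theorem rowPermRep_polytabloid {N : ℕ} {lam : YoungDiagram} (σ : Equiv.Perm (Fin N))
    (t : Tableau N lam) :
    rowPermRep N σ (polytabloid t) = polytabloid ((σ⁻¹ : Equiv.Perm (Fin N)).trans t) := by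
  simp only [polytabloid, map_sum, map_smul]
  refine Finset.sum_bij' (fun π _ => σ * π * σ⁻¹) (fun π _ => σ⁻¹ * π * σ) ?_ ?_ ?_ ?_ ?_
  · intro π hπ
    simp only [columnStabilizer, Finset.mem_filter, Finset.mem_univ, true_and] at hπ ⊢
    intro x
    simpa using hπ (σ⁻¹ x)
  · intro π hπ
    simp only [columnStabilizer, Finset.mem_filter, Finset.mem_univ, true_and] at hπ ⊢
    intro x
    simpa using hπ (σ x)
  · intro π _; group
  · intro π _; group
  · intro π _
    have : (tabloid t ∘ ⇑π⁻¹) ∘ ⇑σ⁻¹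
        = tabloid ((σ⁻¹ : Equiv.Perm (Fin N)).trans t) ∘ ⇑(σ * π * σ⁻¹)⁻¹ := by
      ext x
      simp [tabloid, mul_assoc]
    simp only [map_mul, map_inv]
    rw [show Equiv.Perm.sign σ * Equiv.Perm.sign π * (Equiv.Perm.sign σ)⁻¹
      = Equiv.Perm.sign π from by rw [mul_comm, inv_mul_cancel_left]]
    rw [← this]
    simp [rowPermRep, Finsupp.mapDomain_single]

/-- The Specht module of a Young diagram `lam` with `N` cells: the span of all polytabloids of
shape `lam`, as a subrepresentation. -/
def spechtSub (N : ℕ) (lam : YoungDiagram) : Subrepresentation (rowPermRep N) where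
  toSubmodule := Submodule.span ℂ (Set.range fun t : Tableau N lam => polytabloid t)
  apply_mem_toSubmodule σ v hv := by
    induction hv using Submodule.span_induction with
    | mem x hx =>
      obtain ⟨t, rfl⟩ := hx
      simp only [rowPermRep_polytabloid]
      exact Submodule.subset_span ⟨_, rfl⟩
    | zero => simp
    | add x y _ _ hx hy => rw [map_add]; exact Submodule.add_mem _ hx hy
    | smul a x _ hx => rw [map_smul]; exact Submodule.smul_mem _ a hx

/-- The irreducible representation of `𝔖_N` that corresponds to a Young diagram `lam` with `N`
cells. -/
def spechtRep (N : ℕ) (lam : YoungDiagram) :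
    Representation ℂ (Equiv.Perm (Fin N)) (spechtSub N lam).toSubmodule :=
  (spechtSub N lam).toRepresentation

instance spechtFiniteDimensional (N : ℕ) (lam : YoungDiagram) :
    FiniteDimensional ℂ (spechtSub N lam).toSubmodule :=
  FiniteDimensional.span_of_finite ℂ (Set.finite_range _)

/-- The trace of `R_lam σ`. -/
def spechtChar (N : ℕ) (lam : YoungDiagram) (σ : Equiv.Perm (Fin N)) : ℂ :=
  Representation.character (k := ℂ) (G := Equiv.Perm (Fin N))
    (V := (spechtSub N lam).toSubmodule) (spechtRep N lam) σ

/-- The normalized character `χ_lam σ = Tr (R_lam σ) / Tr (R_lam 1)`. -/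
def spechtNormChar (N : ℕ) (lam : YoungDiagram) (σ : Equiv.Perm (Fin N)) : ℂ :=
  spechtChar N lam σ / spechtChar N lam 1

/-- A function on the subgroup `𝔖_{N_k}` regarded as a function on the inductive limit: it is
extended by zero. -/
def extendToLimitSym (n : ℕ → ℕ) (k : ℕ) (φ : Equiv.Perm (Fin (levelSize n k)) → ℂ) :
    LimitSym n → ℂ :=
  Function.extend (toLimitSym n k) φ 0

end

/-! ### Specht modules over ℂ: irreducibility, and inequivalence of different shapes. -/

section Specht

variable {N : ℕ} {lam mu : YoungDiagram}

/-! Restricted to a finite level, `χ` is a convex combination of normalized irreducible characters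
(`exists_eq_sum_spechtNormChar`). Suppose that some neighbourhood of `χ`, given by a finite set `F`
and `ε`, contains no irreducible character of level at least `m`. Then each of them misses `χ` by at
least `ε` at a point of `F`, hence by at least `ε / 2` in one of four directions of the plane. Sort
the terms of the convex combinations into these finitely many classes and pass to an ultrafilter
limit over the levels: `χ` becomes a finite sum of central positive definite `φ j`.
Indecomposability forces `φ j = φ j 1 * χ`, whereas the one-sided deviation survives the limit, so
`φ j 1` has nonpositive real part for every `j`; this contradicts `χ 1 = 1`. Thus every
neighbourhood contains irreducible characters of arbitrarily high level, and a diagonal choice over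
the finite groups exhausting the limit gives the sequence.

The decomposition at a finite level needs the Specht modules to be all the irreducibles. James'
argument with column antisymmetrizers gives irreducibility (`spechtRep_isIrreducible`). Shapes are
told apart by the sum of the row indices of their cells, which takes the place of the dominance
order (`shape_eq_of_equiv`). Since conjugacy classes are no more numerous than shapes, the
orthonormal Specht characters span the central functions; unitarizability makes the coefficients
nonnegative. -/

theorem mem_columnStabilizer {t : Tableau N lam} {π : Equiv.Perm (Fin N)} :
    π ∈ columnStabilizer t ↔ ∀ x, (t (π x)).1.2 = (t x).1.2 := by
  simp [columnStabilizer]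

theorem one_mem_columnStabilizer (t : Tableau N lam) : 1 ∈ columnStabilizer t := by
  simp [mem_columnStabilizer]

theorem mul_mem_columnStabilizer {t : Tableau N lam} {π τ : Equiv.Perm (Fin N)}
    (hπ : π ∈ columnStabilizer t) (hτ : τ ∈ columnStabilizer t) :
    π * τ ∈ columnStabilizer t := by
  rw [mem_columnStabilizer] at *
  intro x
  rw [Equiv.Perm.mul_apply, hπ, hτ]

theorem inv_mem_columnStabilizer {t : Tableau N lam} {π : Equiv.Perm (Fin N)}
    (hπ : π ∈ columnStabilizer t) : π⁻¹ ∈ columnStabilizer t := by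
  rw [mem_columnStabilizer] at *
  intro x
  simpa using (hπ (π⁻¹ x)).symm

@[simp]
theorem rowPermRep_single (σ : Equiv.Perm (Fin N)) (f : Fin N → ℕ) (a : ℂ) :
    rowPermRep N σ (Finsupp.single f a) = Finsupp.single (f ∘ ⇑σ⁻¹) a := by
  simp [rowPermRep, Finsupp.mapDomain_single]

/-- The signed sum over the column stabilizer of a tableau. -/
noncomputable def columnAntisymmetrizer (t : Tableau N lam) :
    ((Fin N → ℕ) →₀ ℂ) →ₗ[ℂ] ((Fin N → ℕ) →₀ ℂ) :=
  ∑ π ∈ columnStabilizer t, ((Equiv.Perm.sign π : ℤ) : ℂ) • rowPermRep N π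

theorem columnAntisymmetrizer_apply (t : Tableau N lam) (v : (Fin N → ℕ) →₀ ℂ) :
    columnAntisymmetrizer t v =
      ∑ π ∈ columnStabilizer t, ((Equiv.Perm.sign π : ℤ) : ℂ) • rowPermRep N π v := by
  simp [columnAntisymmetrizer]

theorem columnAntisymmetrizer_single_tabloid (t : Tableau N lam) :
    columnAntisymmetrizer t (Finsupp.single (tabloid t) 1) = polytabloid t := by
  simp only [columnAntisymmetrizer_apply, polytabloid, rowPermRep_single]

theorem columnAntisymmetrizer_rowPermRep (t : Tableau N lam) {π : Equiv.Perm (Fin N)}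
    (hπ : π ∈ columnStabilizer t) (v : (Fin N → ℕ) →₀ ℂ) :
    columnAntisymmetrizer t (rowPermRep N π v) =
      ((Equiv.Perm.sign π : ℤ) : ℂ) • columnAntisymmetrizer t v := by
  rw [columnAntisymmetrizer_apply, columnAntisymmetrizer_apply, Finset.smul_sum]
  refine Finset.sum_bij' (fun τ _ => τ * π) (fun τ _ => τ * π⁻¹)
    (fun τ hτ => mul_mem_columnStabilizer hτ hπ)
    (fun τ hτ => mul_mem_columnStabilizer hτ (inv_mem_columnStabilizer hπ))
    (fun τ _ => by group) (fun τ _ => by group) fun τ _ => ?_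
  have h : ((Equiv.Perm.sign π : ℤ) : ℂ) * ((Equiv.Perm.sign π : ℤ) : ℂ) = 1 := by
    rw [← Int.cast_mul, Int.units_coe_mul_self, Int.cast_one]
  rw [smul_smul, map_mul, map_mul, Module.End.mul_apply, Units.val_mul, Int.cast_mul,
    mul_left_comm, h, mul_one]

theorem columnAntisymmetrizer_polytabloid (t : Tableau N lam) :
    columnAntisymmetrizer t (polytabloid t) =
      ((columnStabilizer t).card : ℂ) • polytabloid t := by
  conv_lhs => rw [polytabloid, map_sum]
  rw [Nat.cast_smul_eq_nsmul, ← Finset.sum_const]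
  refine Finset.sum_congr rfl fun π hπ => ?_
  rw [map_smul, ← rowPermRep_single, columnAntisymmetrizer_rowPermRep t hπ, smul_smul,
    ← Int.cast_mul, Int.units_coe_mul_self, Int.cast_one, one_smul,
    columnAntisymmetrizer_single_tabloid]

/-- The transposition of `x` and `y` lies in the column stabilizer and fixes `f`, but has sign -1,
so the image equals its own negative. -/
theorem columnAntisymmetrizer_single_eq_zero (t : Tableau N lam) {f : Fin N → ℕ} {x y : Fin N}
    (hxy : x ≠ y) (hcol : (t x).1.2 = (t y).1.2) (hf : f x = f y) :
    columnAntisymmetrizer t (Finsupp.single f 1) = 0 := by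
  have hmem : Equiv.swap x y ∈ columnStabilizer t := by
    rw [mem_columnStabilizer]
    intro z
    rcases eq_or_ne z x with rfl | hzx
    · rw [Equiv.swap_apply_left, hcol]
    · rcases eq_or_ne z y with rfl | hzy
      · rw [Equiv.swap_apply_right, hcol]
      · rw [Equiv.swap_apply_of_ne_of_ne hzx hzy]
  have hfs : f ∘ ⇑(Equiv.swap x y)⁻¹ = f := by
    ext z
    rw [Equiv.swap_inv, Function.comp_apply]
    rcases eq_or_ne z x with rfl | hzx
    · rw [Equiv.swap_apply_left, hf]
    · rcases eq_or_ne z y with rfl | hzy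
      · rw [Equiv.swap_apply_right, hf]
      · rw [Equiv.swap_apply_of_ne_of_ne hzx hzy]
  have h := columnAntisymmetrizer_rowPermRep t hmem (Finsupp.single f 1)
  rw [rowPermRep_single, hfs, Equiv.Perm.sign_swap hxy] at h
  simpa [self_eq_neg] using h

theorem card_filter_column (t : Tableau N lam) (j : ℕ) :
    (Finset.univ.filter fun y => (t y).1.2 = j).card = lam.colLen j := by
  rw [YoungDiagram.colLen_eq_card]
  refine Finset.card_bij (fun y _ => (t y).1) ?_ ?_ ?_
  · intro y hy
    rw [YoungDiagram.mem_col_iff]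
    exact ⟨(YoungDiagram.mem_cells _).1 (t y).2, by simpa using hy⟩
  · intro y _ z _ h
    exact t.injective (Subtype.ext h)
  · intro c hc
    rw [YoungDiagram.mem_col_iff] at hc
    refine ⟨t.symm ⟨c, (YoungDiagram.mem_cells _).2 hc.1⟩, ?_, ?_⟩ <;> simp [hc.2]

theorem card_filter_tabloid (t : Tableau N lam) (i : ℕ) :
    (Finset.univ.filter fun y => tabloid t y = i).card = lam.rowLen i := by
  rw [YoungDiagram.rowLen_eq_card]
  refine Finset.card_bij (fun y _ => (t y).1) ?_ ?_ ?_
  · intro y hy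
    rw [YoungDiagram.mem_row_iff]
    exact ⟨(YoungDiagram.mem_cells _).1 (t y).2, (Finset.mem_filter.1 hy).2⟩
  · intro y _ z _ h
    exact t.injective (Subtype.ext h)
  · intro c hc
    rw [YoungDiagram.mem_row_iff] at hc
    refine ⟨t.symm ⟨c, (YoungDiagram.mem_cells _).2 hc.1⟩,
      Finset.mem_filter.2 ⟨Finset.mem_univ _, ?_⟩, ?_⟩
    · simp [tabloid, hc.2]
    · simp

theorem shape_eq_of_tabloid_eq {t : Tableau N lam} {s : Tableau N mu}
    (h : tabloid t = tabloid s) : lam = mu := by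
  have hrow : ∀ i, lam.rowLen i = mu.rowLen i := fun i => by
    rw [← card_filter_tabloid t, ← card_filter_tabloid s, h]
  refine SetLike.ext fun c => ?_
  obtain ⟨i, j⟩ := c
  rw [YoungDiagram.mem_iff_lt_rowLen, YoungDiagram.mem_iff_lt_rowLen, hrow]

/-- This total height depends on the shape alone; it is the numerical invariant used to compare
shapes. -/
theorem sum_tabloid (t : Tableau N lam) : ∑ x, tabloid t x = ∑ c ∈ lam.cells, c.1 := by
  rw [← Finset.sum_coe_sort lam.cells]
  exact Equiv.sum_comp t fun c : lam.cells => c.1.1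

/-- A row function that is injective on the columns of a tableau dominates, after sorting the
columns, the tabloid of the tableau. -/
theorem exists_columnStabilizer_tabloid_le (t : Tableau N lam) {f : Fin N → ℕ}
    (hf : ∀ x y, (t x).1.2 = (t y).1.2 → f x = f y → x = y) :
    ∃ π ∈ columnStabilizer t, ∀ x, tabloid t x ≤ f (π x) := by
  -- The size of `below x` is the rank of `x` when its column is sorted by `f`. It is at most `f x`,
  -- because the entries below `x` have distinct values less than `f x`.
  let below : Fin N → Finset (Fin N) := fun x =>
    Finset.univ.filter fun y => (t y).1.2 = (t x).1.2 ∧ f y < f x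
  have hmem : ∀ x y, y ∈ below x ↔ (t y).1.2 = (t x).1.2 ∧ f y < f x := fun x y => by
    simp [below]
  have hlt : ∀ x y, (t x).1.2 = (t y).1.2 → f x < f y → (below x).card < (below y).card := by
    intro x y hc hxy
    refine Finset.card_lt_card (Finset.ssubset_iff_of_subset ?_ |>.2 ⟨x, ?_, ?_⟩)
    · intro z hz
      rw [hmem] at hz ⊢
      exact ⟨hz.1.trans hc, hz.2.trans hxy⟩
    · rw [hmem]; exact ⟨hc, hxy⟩
    · rw [hmem]; simp
  have hle : ∀ x, (below x).card ≤ f x := by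
    intro x
    rw [← Finset.card_range (f x)]
    refine Finset.card_le_card_of_injOn f ?_ ?_
    · intro y hy
      simpa using ((hmem x y).1 hy).2
    · intro y hy z hz h
      exact hf y z (((hmem x y).1 hy).1.trans ((hmem x z).1 hz).1.symm) h
  have hcell : ∀ x, ((below x).card, (t x).1.2) ∈ lam.cells := by
    intro x
    rw [YoungDiagram.mem_cells, YoungDiagram.mem_iff_lt_colLen, ← card_filter_column t]
    refine Finset.card_lt_card (Finset.ssubset_iff_of_subset ?_ |>.2 ⟨x, by simp, ?_⟩)
    · intro z hz
      simpa using ((hmem x z).1 hz).1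
    · rw [hmem]; simp
  let c : Fin N → lam.cells := fun x => ⟨_, hcell x⟩
  have hinj : Function.Injective c := by
    intro x y hxy
    have h1 : (below x).card = (below y).card := congrArg (fun c => c.1.1) hxy
    have h2 : (t x).1.2 = (t y).1.2 := congrArg (fun c => c.1.2) hxy
    refine hf x y h2 ?_
    rcases lt_trichotomy (f x) (f y) with h | h | h
    · exact absurd h1 (hlt x y h2 h).ne
    · exact h
    · exact absurd h1 (hlt y x h2.symm h).ne'
  have hbij : Function.Bijective c :=
    (Fintype.bijective_iff_injective_and_card c).2 ⟨hinj, Fintype.card_congr t⟩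
  let e : Fin N ≃ lam.cells := Equiv.ofBijective c hbij
  have he : ∀ x, e (e.symm (t x)) = t x := fun x => e.apply_symm_apply _
  have h1 : ∀ x, (below (e.symm (t x))).card = (t x).1.1 := fun x =>
    congrArg (fun c => c.1.1) (he x)
  have h2 : ∀ x, (t (e.symm (t x))).1.2 = (t x).1.2 := fun x =>
    congrArg (fun c => c.1.2) (he x)
  -- The permutation sends `x` to the entry of its column whose rank is the row of `x`.
  refine ⟨t.trans e.symm, mem_columnStabilizer.2 h2, fun x => ?_⟩
  rw [tabloid, ← h1]
  exact hle _

/-- If the antisymmetrizer of a tableau does not kill a row function of no larger total height,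
then the row function arises from the tabloid by a column permutation. -/
theorem exists_of_columnAntisymmetrizer_single_ne_zero (t : Tableau N lam) {f : Fin N → ℕ}
    (h : columnAntisymmetrizer t (Finsupp.single f 1) ≠ 0) :
    ∑ x, tabloid t x ≤ ∑ x, f x ∧ (∑ x, tabloid t x = ∑ x, f x →
      ∃ π ∈ columnStabilizer t, f ∘ ⇑π = tabloid t) := by
  obtain ⟨π, hπ, hle⟩ := exists_columnStabilizer_tabloid_le t (f := f) fun x y hc hf => by
    by_contra hxy
    exact h (columnAntisymmetrizer_single_eq_zero t hxy hc hf)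
  rw [← Equiv.sum_comp π f]
  refine ⟨Finset.sum_le_sum fun x _ => hle x, fun heq => ⟨π, hπ, ?_⟩⟩
  ext x
  exact ((Finset.sum_eq_sum_iff_of_le fun x _ => hle x).1 heq x (Finset.mem_univ x)).symm

theorem tabloid_trans (t : Tableau N lam) (π : Equiv.Perm (Fin N)) :
    tabloid ((π : Equiv.Perm (Fin N)).trans t) = tabloid t ∘ ⇑π := rfl

theorem spechtSub_le_span_tabloid (N : ℕ) (mu : YoungDiagram) :
    (spechtSub N mu).toSubmodule ≤
      Submodule.span ℂ (Set.range fun s : Tableau N mu => Finsupp.single (tabloid s) (1 : ℂ)) := by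
  refine Submodule.span_le.2 ?_
  rintro _ ⟨s, rfl⟩
  refine Submodule.sum_mem _ fun π _ => Submodule.smul_mem _ _ (Submodule.subset_span ?_)
  exact ⟨(π⁻¹ : Equiv.Perm (Fin N)).trans s, rfl⟩

/-- Tabloids of the same shape have equal total height, so one that is not killed is a column
permutation of `tabloid t` and goes to plus or minus `polytabloid t`. -/
theorem columnAntisymmetrizer_mem_span (t : Tableau N lam) {v : (Fin N → ℕ) →₀ ℂ}
    (hv : v ∈ (spechtSub N lam).toSubmodule) :
    columnAntisymmetrizer t v ∈ Submodule.span ℂ {polytabloid t} := by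
  suffices h : (spechtSub N lam).toSubmodule ≤
      (Submodule.span ℂ {polytabloid t}).comap (columnAntisymmetrizer t) from h hv
  refine (spechtSub_le_span_tabloid N lam).trans (Submodule.span_le.2 ?_)
  rintro _ ⟨s, rfl⟩
  rw [SetLike.mem_coe, Submodule.mem_comap]
  by_cases h0 : columnAntisymmetrizer t (Finsupp.single (tabloid s) 1) = 0
  · rw [h0]; exact Submodule.zero_mem _
  · obtain ⟨π, hπ, h⟩ := (exists_of_columnAntisymmetrizer_single_ne_zero t h0).2
      ((sum_tabloid t).trans (sum_tabloid s).symm)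
    have hs : Finsupp.single (tabloid s) (1 : ℂ) =
        rowPermRep N π (Finsupp.single (tabloid t) 1) := by
      rw [rowPermRep_single, ← h, Function.comp_assoc]
      congr 1
      ext x
      simp
    dsimp only
    rw [hs, columnAntisymmetrizer_rowPermRep t hπ, columnAntisymmetrizer_single_tabloid]
    exact Submodule.smul_mem _ _ (Submodule.mem_span_singleton_self _)

/-- Some tabloid of shape `mu` must survive the antisymmetrizer, and then its total height bounds
that of `t`; in case of equality the two tabloids differ by a permutation, so their row lengths
agree. -/
theorem shape_constraint_of_columnAntisymmetrizer_ne_zero (t : Tableau N lam)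
    {v : (Fin N → ℕ) →₀ ℂ} (hv : v ∈ (spechtSub N mu).toSubmodule)
    (h : columnAntisymmetrizer t v ≠ 0) :
    ∑ c ∈ lam.cells, c.1 ≤ ∑ c ∈ mu.cells, c.1 ∧
      (∑ c ∈ lam.cells, c.1 = ∑ c ∈ mu.cells, c.1 → lam = mu) := by
  by_contra hcon
  refine h ?_
  suffices h : (spechtSub N mu).toSubmodule ≤ LinearMap.ker (columnAntisymmetrizer t) from h hv
  refine (spechtSub_le_span_tabloid N mu).trans (Submodule.span_le.2 ?_)
  rintro _ ⟨s, rfl⟩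
  rw [SetLike.mem_coe, LinearMap.mem_ker]
  by_contra h0
  have := exists_of_columnAntisymmetrizer_single_ne_zero t h0
  rw [sum_tabloid, sum_tabloid] at this
  refine hcon ⟨this.1, fun heq => ?_⟩
  obtain ⟨π, -, hπ⟩ := this.2 heq
  exact shape_eq_of_tabloid_eq (hπ.symm.trans (tabloid_trans s π).symm)

theorem polytabloid_mem (t : Tableau N lam) :
    polytabloid t ∈ (spechtSub N lam).toSubmodule :=
  Submodule.subset_span ⟨t, rfl⟩

/-- Only the identity preserves both rows and columns, so `tabloid t` occurs with coefficient 1. -/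
theorem polytabloid_ne_zero (t : Tableau N lam) : polytabloid t ≠ 0 := by
  intro h
  have h1 : polytabloid t (tabloid t) = 1 := by
    rw [polytabloid, Finsupp.finsetSum_apply,
      Finset.sum_eq_single_of_mem 1 (one_mem_columnStabilizer t)]
    · simp
    · intro π hπ hne
      rw [Finsupp.smul_apply, Finsupp.single_eq_of_ne, smul_zero]
      intro heq
      refine hne (Equiv.ext fun x => t.injective (Subtype.ext (Prod.ext ?_ ?_)))
      · have := congrFun heq (π x)
        simpa [tabloid] using this
      · exact mem_columnStabilizer.1 hπ x
  rw [h] at h1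
  simp at h1

/-- An element of the Specht module that is killed by all column antisymmetrizers is zero. -/
theorem eq_zero_of_columnAntisymmetrizer_eq_zero {v : (Fin N → ℕ) →₀ ℂ}
    (hv : v ∈ (spechtSub N lam).toSubmodule)
    (h : ∀ t : Tableau N lam, columnAntisymmetrizer t v = 0) : v = 0 := by
  -- `L` is the Hermitian pairing with `v`. The antisymmetrizer is self-adjoint, so `L` sends
  -- `polytabloid t` to the conjugate of the coefficient of `columnAntisymmetrizer t v` at `tabloid
  -- t`, which is zero. Hence `L` vanishes on `v` itself, and the squared norm of `v` is zero.
  let L : ((Fin N → ℕ) →₀ ℂ) →ₗ[ℂ] ℂ := Finsupp.linearCombination ℂ fun f => star (v f)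
  have hrep : ∀ (π : Equiv.Perm (Fin N)) (f : Fin N → ℕ), rowPermRep N π v f = v (f ∘ ⇑π) := by
    intro π f
    have hinj : Function.Injective fun f : Fin N → ℕ => f ∘ ⇑π⁻¹ :=
      π⁻¹.surjective.injective_comp_right
    have := Finsupp.mapDomain_apply hinj v (f ∘ ⇑π)
    rw [Function.comp_assoc, show ⇑π ∘ ⇑π⁻¹ = id by ext; simp, Function.comp_id] at this
    exact this
  have hL : (spechtSub N lam).toSubmodule ≤ LinearMap.ker L := by
    refine Submodule.span_le.2 ?_
    rintro _ ⟨t, rfl⟩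
    rw [SetLike.mem_coe, LinearMap.mem_ker]
    have h0 := congrArg star (DFunLike.congr_fun (h t) (tabloid t))
    rw [columnAntisymmetrizer_apply, Finsupp.finsetSum_apply, star_sum] at h0
    simp only [polytabloid, map_sum, map_smul]
    rw [Finsupp.zero_apply, star_zero] at h0
    rw [← h0]
    refine Finset.sum_bij' (fun π _ => π⁻¹) (fun π _ => π⁻¹)
      (fun π hπ => inv_mem_columnStabilizer hπ) (fun π hπ => inv_mem_columnStabilizer hπ)
      (fun π _ => inv_inv π) (fun π _ => inv_inv π) fun π _ => ?_
    simp [L, hrep]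
  have h0 : L v = 0 := hL hv
  rw [Finsupp.linearCombination_apply, Finsupp.sum] at h0
  have h1 := (Finset.sum_eq_zero_iff_of_nonneg fun f _ => mul_star_self_nonneg (v f)).1 h0
  ext f
  by_contra hf
  have := h1 f (Finsupp.mem_support_iff.2 hf)
  simp at this
  exact hf this

theorem columnAntisymmetrizer_mem (W : Subrepresentation (rowPermRep N)) (t : Tableau N lam)
    {v : (Fin N → ℕ) →₀ ℂ} (hv : v ∈ W.toSubmodule) :
    columnAntisymmetrizer t v ∈ W.toSubmodule := by
  rw [columnAntisymmetrizer_apply]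
  exact Submodule.sum_mem _ fun π _ => Submodule.smul_mem _ _ (W.apply_mem_toSubmodule π hv)

theorem exists_tableau (h : lam.card = N) : Nonempty (Tableau N lam) :=
  ⟨Fintype.equivOfCardEq (by rw [Fintype.card_fin, Fintype.card_coe]; exact h.symm)⟩

/-- James' submodule theorem. -/
theorem spechtSub_le_of_mem (W : Subrepresentation (rowPermRep N)) {v : (Fin N → ℕ) →₀ ℂ}
    (hv : v ∈ (spechtSub N lam).toSubmodule) (hvW : v ∈ W.toSubmodule) (h0 : v ≠ 0) :
    (spechtSub N lam).toSubmodule ≤ W.toSubmodule := by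
  obtain ⟨t, ht⟩ : ∃ t : Tableau N lam, columnAntisymmetrizer t v ≠ 0 := by
    by_contra! hcon
    exact h0 (eq_zero_of_columnAntisymmetrizer_eq_zero hv hcon)
  obtain ⟨c, hc⟩ := Submodule.mem_span_singleton.1 (columnAntisymmetrizer_mem_span t hv)
  have hc0 : c ≠ 0 := by
    rintro rfl
    exact ht (by rw [← hc, zero_smul])
  have hpt : polytabloid t ∈ W.toSubmodule := by
    have := Submodule.smul_mem _ c⁻¹ (columnAntisymmetrizer_mem W t hvW)
    rwa [← hc, smul_smul, inv_mul_cancel₀ hc0, one_smul] at this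
  refine Submodule.span_le.2 ?_
  rintro _ ⟨s, rfl⟩
  -- The symmetric group permutes the tableaux of a shape transitively, so one polytabloid generates
  -- them all.
  have := W.apply_mem_toSubmodule (t.trans s.symm) hpt
  rw [rowPermRep_polytabloid] at this
  have hs : ((t.trans s.symm : Equiv.Perm (Fin N))⁻¹ : Equiv.Perm (Fin N)).trans t = s := by
    ext1 x
    change t (t.symm (s x)) = s x
    simp
  rwa [hs] at this

theorem spechtRep_isIrreducible (h : lam.card = N) :
    Representation.IsIrreducible (k := ℂ) (V := (spechtSub N lam).toSubmodule)
      (spechtRep N lam) := by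
  obtain ⟨t⟩ := exists_tableau h
  have hnt : Nontrivial (Subrepresentation (spechtRep N lam)) := by
    refine ⟨⊥, ⊤, fun hbt => polytabloid_ne_zero t ?_⟩
    have hmem : (⟨polytabloid t, polytabloid_mem t⟩ : (spechtSub N lam).toSubmodule) ∈
        (⊥ : Subrepresentation (spechtRep N lam)).toSubmodule := by
      rw [hbt]; trivial
    exact congrArg Subtype.val ((Submodule.mem_bot ℂ).1 hmem)
  refine { hnt with eq_bot_or_eq_top := fun W => ?_ }
  -- The submodule theorem concerns the ambient permutation module, so `W` is pushed forward to it.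
  let W' : Subrepresentation (rowPermRep N) :=
    { toSubmodule := W.toSubmodule.map (spechtSub N lam).toSubmodule.subtype
      apply_mem_toSubmodule := by
        rintro g _ ⟨w, hw, rfl⟩
        exact ⟨_, W.apply_mem_toSubmodule g hw, rfl⟩ }
  by_cases hW : W.toSubmodule = ⊥
  · exact Or.inl (Subrepresentation.toSubmodule_injective hW)
  · obtain ⟨w, hw, hw0⟩ := Submodule.exists_mem_ne_zero_of_ne_bot hW
    right
    refine Subrepresentation.toSubmodule_injective (Submodule.eq_top_iff'.2 fun v => ?_)
    have := spechtSub_le_of_mem W' w.2 ⟨w, hw, rfl⟩ (by simpa using hw0) v.2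
    obtain ⟨v', hv', hvv⟩ := this
    rwa [← Subtype.ext hvv]

/-- The antisymmetrizer comes from the group algebra and so commutes with `φ`. It multiplies
`polytabloid t` by the order of the column stabilizer, hence does not kill the image of `polytabloid
t`. -/
theorem shape_constraint_of_equiv (h : lam.card = N)
    (φ : Representation.Equiv (spechtRep N lam) (spechtRep N mu)) :
    ∑ c ∈ lam.cells, c.1 ≤ ∑ c ∈ mu.cells, c.1 ∧
      (∑ c ∈ lam.cells, c.1 = ∑ c ∈ mu.cells, c.1 → lam = mu) := by
  obtain ⟨t⟩ := exists_tableau h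
  let e : (spechtSub N lam).toSubmodule := ⟨polytabloid t, polytabloid_mem t⟩
  have hκ : columnAntisymmetrizer t (φ e : (spechtSub N mu).toSubmodule).1 =
      (φ (((columnStabilizer t).card : ℂ) • e) : (spechtSub N mu).toSubmodule).1 := by
    have he : ((columnStabilizer t).card : ℂ) • e =
        ∑ π ∈ columnStabilizer t, ((Equiv.Perm.sign π : ℤ) : ℂ) • spechtRep N lam π e := by
      apply Subtype.ext
      rw [Submodule.coe_smul, ← columnAntisymmetrizer_polytabloid, columnAntisymmetrizer_apply,
        AddSubmonoidClass.coe_finsetSum]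
      rfl
    rw [he, map_sum, columnAntisymmetrizer_apply, AddSubmonoidClass.coe_finsetSum]
    refine Finset.sum_congr rfl fun π _ => ?_
    rw [map_smul]
    have := LinearMap.congr_fun (φ.toIntertwiningMap.isIntertwining' π) e
    exact congrArg (fun w : (spechtSub N mu).toSubmodule =>
      ((Equiv.Perm.sign π : ℤ) : ℂ) • w.1) this.symm
  refine shape_constraint_of_columnAntisymmetrizer_ne_zero t (φ e).2 ?_
  rw [hκ]
  intro h0
  have h1 : ((columnStabilizer t).card : ℂ) • e = 0 := by
    have h2 : φ (((columnStabilizer t).card : ℂ) • e) = 0 := Subtype.ext h0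
    exact φ.toLinearEquiv.map_eq_zero_iff.1 h2
  rcases smul_eq_zero.1 h1 with h2 | h2
  · rw [Nat.cast_eq_zero, Finset.card_eq_zero] at h2
    exact absurd (one_mem_columnStabilizer t) (by rw [h2]; simp)
  · exact polytabloid_ne_zero t (congrArg Subtype.val h2)

theorem shape_eq_of_equiv (hl : lam.card = N) (hm : mu.card = N)
    (φ : Representation.Equiv (spechtRep N lam) (spechtRep N mu)) : lam = mu :=
  have h := shape_constraint_of_equiv hl φ
  h.2 (h.1.antisymm (shape_constraint_of_equiv hm φ.symm).1)

end Specht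

/-! ### Positive definite functions and characters on finite groups. -/

section PositiveDefinite

variable {G : Type*} [Group G]

theorem IsPosDefFun.posSemidef {φ : G → ℂ} (hφ : IsPosDefFun φ) {ι : Type*} [Finite ι]
    (g : ι → G) : (Matrix.of fun i j => φ (g i * (g j)⁻¹)).PosSemidef := by
  have := (hφ _ (g ∘ (Finite.equivFin ι).symm)).submatrix (Finite.equivFin ι)
  convert this using 1
  ext i j
  simp

theorem IsPosDefFun.sum_mul_star_nonneg {φ : G → ℂ} (hφ : IsPosDefFun φ) [Fintype G]
    (x : G → ℂ) : 0 ≤ ∑ g, ∑ h, φ (g * h⁻¹) * (star (x g) * x h) := by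
  have := (Matrix.posSemidef_iff_dotProduct_mulVec.1 (hφ.posSemidef id)).2 x
  simp only [dotProduct, Matrix.mulVec, Finset.mul_sum, Matrix.of_apply, id] at this
  refine this.trans_eq (Finset.sum_congr rfl fun g _ => Finset.sum_congr rfl fun h _ => ?_)
  rw [Pi.star_apply, mul_left_comm]

open scoped MatrixOrder Matrix.Norms.L2Operator in
/-- A finite-dimensional complex representation of a finite group is unitarizable. -/
theorem exists_unitary_matrices [Finite G] {V : Type*} [AddCommGroup V] [Module ℂ V]
    [FiniteDimensional ℂ V] (ρ : Representation ℂ G V) :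
    ∃ (n : ℕ) (U : G → Matrix (Fin n) (Fin n) ℂ),
      (∀ g h, U (g * h⁻¹) = U g * (U h).conjTranspose) ∧ ∀ g, ρ.character g = (U g).trace := by
  classical
  have := Fintype.ofFinite G
  let b := Module.finBasis ℂ V
  let M : G → Matrix (Fin (Module.finrank ℂ V)) (Fin (Module.finrank ℂ V)) ℂ :=
    fun g => LinearMap.toMatrix b b (ρ g)
  have hM1 : M 1 = 1 := by simp [M]
  have hMmul : ∀ g h, M (g * h) = M g * M h := fun g h => by
    simp only [M, map_mul, LinearMap.toMatrix_mul]
  -- The Gram matrix of an invariant inner product, obtained by averaging. Writing it as `star B *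
  -- B` and conjugating by `B` makes the representation unitary.
  let P := ∑ h, (M h).conjTranspose * M h
  have hP : P.PosDef := by
    have h1 : P = 1 + ∑ h ∈ Finset.univ.erase (1 : G), (M h).conjTranspose * M h := by
      simp only [P]
      rw [← Finset.add_sum_erase _ _ (Finset.mem_univ (1 : G)), hM1]
      simp
    rw [h1]
    exact Matrix.PosDef.one.add_posSemidef
      (Matrix.posSemidef_sum _ fun h _ => Matrix.posSemidef_conjTranspose_mul_self _)
  have hPinv : ∀ g, (M g).conjTranspose * P * M g = P := by
    intro g
    simp only [P, Finset.mul_sum, Finset.sum_mul]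
    refine Fintype.sum_equiv (Equiv.mulRight g) _ _ fun h => ?_
    simp [hMmul, Matrix.mul_assoc]
  obtain ⟨B, hB⟩ := CStarAlgebra.nonneg_iff_eq_star_mul_self.mp hP.posSemidef.nonneg
  rw [Matrix.star_eq_conjTranspose] at hB
  have hBdet : IsUnit B.det := by
    have h := (Matrix.isUnit_iff_isUnit_det P).1 hP.isUnit
    rw [hB, Matrix.det_mul] at h
    exact isUnit_of_mul_isUnit_right h
  have hBB : B⁻¹ * B = 1 := Matrix.nonsing_inv_mul _ hBdet
  have hBB' : B * B⁻¹ = 1 := Matrix.mul_nonsing_inv _ hBdet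
  have hcc : (B⁻¹).conjTranspose * B.conjTranspose = 1 := by
    rw [← Matrix.conjTranspose_mul, hBB', Matrix.conjTranspose_one]
  have hinv : ∀ h, B * M h⁻¹ * B⁻¹ = (B * M h * B⁻¹).conjTranspose := by
    intro h
    have h1 : P * M h⁻¹ = (M h).conjTranspose * P := by
      conv_lhs => rw [← hPinv h]
      rw [Matrix.mul_assoc, ← hMmul, mul_inv_cancel, hM1, Matrix.mul_one]
    rw [hB] at h1
    calc B * M h⁻¹ * B⁻¹
        = (B⁻¹).conjTranspose * (B.conjTranspose * B * M h⁻¹) * B⁻¹ := by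
          rw [← Matrix.mul_assoc, ← Matrix.mul_assoc, hcc, Matrix.one_mul]
      _ = (B⁻¹).conjTranspose * ((M h).conjTranspose * (B.conjTranspose * B)) * B⁻¹ := by
          rw [h1]
      _ = (B⁻¹).conjTranspose * (M h).conjTranspose * B.conjTranspose * (B * B⁻¹) := by
          simp only [Matrix.mul_assoc]
      _ = (B * M h * B⁻¹).conjTranspose := by
          rw [hBB', Matrix.mul_one, Matrix.conjTranspose_mul, Matrix.conjTranspose_mul,
            Matrix.mul_assoc]
  refine ⟨_, fun g => B * M g * B⁻¹, fun g h => ?_, fun g => ?_⟩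
  · beta_reduce
    rw [← hinv, hMmul]
    calc B * (M g * M h⁻¹) * B⁻¹ = B * M g * 1 * M h⁻¹ * B⁻¹ := by
          simp only [Matrix.mul_one, Matrix.mul_assoc]
      _ = B * M g * B⁻¹ * (B * M h⁻¹ * B⁻¹) := by
          rw [← hBB]; simp only [Matrix.mul_assoc]
  · rw [Matrix.trace_mul_comm, ← Matrix.mul_assoc, hBB, Matrix.one_mul, Representation.character,
      LinearMap.trace_eq_matrix_trace ℂ b]

/-- The trace of `U g * (U h)ᴴ` is the Hilbert–Schmidt inner product of `U g` and `U h`, so the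
matrix in question is a Gram matrix. -/
theorem isPosDefFun_character [Finite G] {V : Type*} [AddCommGroup V] [Module ℂ V]
    [FiniteDimensional ℂ V] (ρ : Representation ℂ G V) : IsPosDefFun ρ.character := by
  obtain ⟨n, U, hU, hχ⟩ := exists_unitary_matrices ρ
  intro m g
  let A : Matrix (Fin m) (Fin n × Fin n) ℂ := Matrix.of fun i p => U (g i) p.1 p.2
  convert Matrix.posSemidef_self_mul_conjTranspose A using 1
  ext i j
  simp only [Matrix.of_apply, hχ, hU, Matrix.trace, Matrix.diag, Matrix.mul_apply,
    Matrix.conjTranspose_apply, A, Fintype.sum_prod_type]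

/-- After translating by `h`, averaging, and expanding the trace, the sum becomes a sum of the
quadratic form of `φ` over the matrix coefficients of a unitary model. -/
theorem IsPosDefFun.sum_mul_character_inv_nonneg {φ : G → ℂ} (hφ : IsPosDefFun φ) [Fintype G]
    {V : Type*} [AddCommGroup V] [Module ℂ V] [FiniteDimensional ℂ V]
    (ρ : Representation ℂ G V) : 0 ≤ ∑ g, φ g * ρ.character g⁻¹ := by
  obtain ⟨n, U, hU, hχ⟩ := exists_unitary_matrices ρ
  have h1 : (Fintype.card G : ℂ) * ∑ g, φ g * ρ.character g⁻¹ =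
      ∑ a, ∑ b, ∑ g, ∑ h, φ (g * h⁻¹) * (star (U g a b) * U h a b) := by
    calc (Fintype.card G : ℂ) * ∑ g, φ g * ρ.character g⁻¹
        = ∑ _h : G, ∑ g, φ g * ρ.character g⁻¹ := by
          rw [Finset.sum_const, Finset.card_univ, nsmul_eq_mul]
      _ = ∑ h, ∑ g, φ (g * h⁻¹) * ρ.character (h * g⁻¹) := by
          refine Finset.sum_congr rfl fun h _ =>
            Fintype.sum_equiv (Equiv.mulRight h) _ _ fun g => ?_
          simp
      _ = ∑ g, ∑ h, ∑ a, ∑ b, φ (g * h⁻¹) * (star (U g a b) * U h a b) := by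
          rw [Finset.sum_comm]
          refine Finset.sum_congr rfl fun g _ => Finset.sum_congr rfl fun h _ => ?_
          simp only [hχ, hU, Matrix.trace, Matrix.diag, Matrix.mul_apply,
            Matrix.conjTranspose_apply, Finset.mul_sum]
          refine Finset.sum_congr rfl fun a _ => Finset.sum_congr rfl fun b _ => ?_
          ring
      _ = ∑ a, ∑ b, ∑ g, ∑ h, φ (g * h⁻¹) * (star (U g a b) * U h a b) := by
          calc _ = ∑ g, ∑ a, ∑ b, ∑ h, φ (g * h⁻¹) * (star (U g a b) * U h a b) :=
                Finset.sum_congr rfl fun g _ => by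
                  rw [Finset.sum_comm]
                  exact Finset.sum_congr rfl fun a _ => Finset.sum_comm
            _ = _ := by
                  rw [Finset.sum_comm]
                  exact Finset.sum_congr rfl fun a _ => Finset.sum_comm
  have h2 : 0 ≤ (Fintype.card G : ℂ) * ∑ g, φ g * ρ.character g⁻¹ := by
    rw [h1]
    exact Finset.sum_nonneg fun a _ => Finset.sum_nonneg fun b _ => hφ.sum_mul_star_nonneg _
  have h3 := mul_nonneg (inv_nonneg.2 (Nat.cast_nonneg (α := ℂ) (Fintype.card G))) h2
  rwa [inv_mul_cancel_left₀ (by simp)] at h3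

/-- An orthonormal family of central functions with at least as many members as there are
conjugacy classes spans the central functions. -/
theorem IsCentralFun.eq_sum_of_orthonormal [Fintype G] {ι : Type*} [Fintype ι] [DecidableEq ι]
    (X : ι → G → ℂ) (hX : ∀ i, IsCentralFun (X i))
    (horth : ∀ i j, ∑ g, X i g * X j g⁻¹ = if i = j then (Fintype.card G : ℂ) else 0)
    (hcard : Nat.card (ConjClasses G) ≤ Fintype.card ι) {φ : G → ℂ} (hφ : IsCentralFun φ) (g : G) :
    φ g = ∑ i, ((Fintype.card G : ℂ)⁻¹ * ∑ h, φ h * X i h⁻¹) * X i g := by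
  classical
  have hG : (Fintype.card G : ℂ) ≠ 0 := by simp
  have hlift : ∀ {ψ : G → ℂ}, IsCentralFun ψ →
      ∃ Ψ : ConjClasses G → ℂ, ∀ g, Ψ (ConjClasses.mk g) = ψ g := by
    intro ψ hψ
    refine ⟨Quotient.lift ψ ?_, fun g => rfl⟩
    rintro a b hab
    obtain ⟨c, rfl⟩ := isConj_iff.1 (show IsConj a b from hab)
    rw [hψ, inv_mul_cancel_left]
  choose Y hY using fun i => hlift (hX i)
  obtain ⟨Φ, hΦ⟩ := hlift hφ
  have hcoef : ∀ (a : ι → ℂ) (ψ : G → ℂ), (∀ g, ∑ i, a i * X i g = ψ g) →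
      ∀ j, ∑ g, ψ g * X j g⁻¹ = (Fintype.card G : ℂ) * a j := by
    intro a ψ h j
    simp_rw [← h, Finset.sum_mul]
    rw [Finset.sum_comm]
    simp_rw [mul_assoc, ← Finset.mul_sum, horth]
    simp [mul_comm]
  have hli : LinearIndependent ℂ Y := by
    rw [Fintype.linearIndependent_iff]
    intro a ha j
    have := hcoef a 0 (fun g => by simpa [hY] using congrFun ha (ConjClasses.mk g)) j
    simpa using this.symm
  -- The family is independent and at least as large as the dimension of the space of functions on
  -- conjugacy classes.
  have hspan : Submodule.span ℂ (Set.range Y) = ⊤ := by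
    refine hli.span_eq_top_of_card_eq_finrank' ?_
    refine le_antisymm hli.fintype_card_le_finrank ?_
    rwa [Module.finrank_fintype_fun_eq_card, ← Nat.card_eq_fintype_card]
  obtain ⟨a, ha⟩ := (Submodule.mem_span_range_iff_exists_fun ℂ).1
    (show Φ ∈ Submodule.span ℂ (Set.range Y) by rw [hspan]; trivial)
  have hval : ∀ g, ∑ i, a i * X i g = φ g := fun g => by
    simpa [hY, hΦ] using congrFun ha (ConjClasses.mk g)
  simp_rw [hcoef a φ hval, inv_mul_cancel_left₀ hG]
  exact (hval g).symm

end PositiveDefinite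

/-! ### Completeness of the Specht characters and decomposition of central functions. -/

section SpechtDecomposition

theorem card_cellsOfRowLens (w : List ℕ) : (YoungDiagram.cellsOfRowLens w).card = w.sum := by
  induction w with
  | nil => rfl
  | cons a w ih =>
    rw [YoungDiagram.cellsOfRowLens, Finset.card_union_of_disjoint, Finset.card_map, ih,
      Finset.card_product, Finset.card_singleton, Finset.card_range, one_mul, List.sum_cons]
    rw [Finset.disjoint_left]
    rintro ⟨i, j⟩ h1 h2
    simp at h1 h2
    omega

/-- The Young diagram of a partition. -/
def Nat.Partition.toYoungDiagram {N : ℕ} (p : N.Partition) : YoungDiagram :=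
  YoungDiagram.ofRowLens (p.parts.sort (· ≥ ·)) (p.parts.pairwise_sort (· ≥ ·)).sortedGE

theorem Nat.Partition.card_toYoungDiagram {N : ℕ} (p : N.Partition) :
    p.toYoungDiagram.card = N := by
  refine (card_cellsOfRowLens _).trans ?_
  rw [← Multiset.sum_coe, Multiset.sort_eq, p.parts_sum]

theorem Nat.Partition.toYoungDiagram_injective {N : ℕ} :
    Function.Injective (Nat.Partition.toYoungDiagram (N := N)) := by
  intro p q h
  have key : ∀ p : N.Partition, (p.toYoungDiagram.rowLens : Multiset ℕ) = p.parts := by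
    intro p
    rw [toYoungDiagram, YoungDiagram.rowLens_ofRowLens_eq_self, Multiset.sort_eq]
    intro x hx
    exact p.parts_pos (by simpa using hx)
  exact Nat.Partition.ext (by rw [← key p, h, key q])

instance finite_youngDiagram (N : ℕ) : Finite {lam : YoungDiagram // lam.card = N} := by
  refine Finite.of_injective (β := (Finset.range N ×ˢ Finset.range N).powerset)
    (fun lam => ⟨lam.1.cells, ?_⟩) ?_
  · rw [Finset.mem_powerset]
    rintro ⟨i, j⟩ h
    have h1 : lam.1.colLen j ≤ lam.1.card :=
      (lam.1.colLen_eq_card).trans_le (Finset.card_filter_le _ _)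
    have h2 : lam.1.rowLen i ≤ lam.1.card :=
      (lam.1.rowLen_eq_card).trans_le (Finset.card_filter_le _ _)
    rw [YoungDiagram.mem_cells] at h
    have h3 := YoungDiagram.mem_iff_lt_colLen.1 h
    have h4 := YoungDiagram.mem_iff_lt_rowLen.1 h
    have h5 := lam.2
    rw [Finset.mem_product, Finset.mem_range, Finset.mem_range]
    constructor <;> dsimp only <;> omega
  · intro lam mu h
    exact Subtype.ext (YoungDiagram.ext (congrArg Subtype.val h))

/-- The cycle type determines the conjugacy class, and a partition is recovered from the row lengths
of its diagram. The inequality is all that spanning requires. -/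
theorem card_conjClasses_perm_le (N : ℕ) :
    Nat.card (ConjClasses (Equiv.Perm (Fin N))) ≤
      Nat.card {lam : YoungDiagram // lam.card = N} := by
  let F : ConjClasses (Equiv.Perm (Fin N)) → (Fintype.card (Fin N)).Partition :=
    Quotient.lift Equiv.Perm.partition fun a b hab => Equiv.Perm.partition_eq_of_isConj.1 hab
  have hF : Function.Injective F := by
    intro a b
    induction a using Quotient.inductionOn with | _ a =>
    induction b using Quotient.inductionOn with | _ b =>
    intro h
    exact Quotient.sound (Equiv.Perm.partition_eq_of_isConj.2 h)
  refine Nat.card_le_card_of_injective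
    (fun c => ⟨(F c).toYoungDiagram, (F c).card_toYoungDiagram.trans (Fintype.card_fin N)⟩) ?_
  intro a b h
  exact hF (Nat.Partition.toYoungDiagram_injective (congrArg Subtype.val h))

theorem isCentralFun_spechtChar (N : ℕ) (lam : YoungDiagram) :
    IsCentralFun (spechtChar N lam) := fun _ _ => Representation.char_mul_comm _ _ _

theorem isPosDefFun_spechtChar (N : ℕ) (lam : YoungDiagram) :
    IsPosDefFun (spechtChar N lam) := isPosDefFun_character _

theorem spechtChar_orthonormal {N : ℕ} {lam mu : YoungDiagram} (hl : lam.card = N)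
    (hm : mu.card = N) [Decidable (lam = mu)] :
    ∑ g, spechtChar N lam g * spechtChar N mu g⁻¹ =
      if lam = mu then (Fintype.card (Equiv.Perm (Fin N)) : ℂ) else 0 := by
  classical
  have hG : (Nat.card (Equiv.Perm (Fin N)) : ℂ) ≠ 0 := by simp
  have := invertibleOfNonzero hG
  have := spechtRep_isIrreducible hl
  have := spechtRep_isIrreducible hm
  have h := Representation.char_orthonormal (k := ℂ) (V := (spechtSub N lam).toSubmodule)
    (W := (spechtSub N mu).toSubmodule) (spechtRep N lam) (spechtRep N mu)
  rw [inv_mul_eq_iff_eq_mul₀ hG, Nat.card_eq_fintype_card] at h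
  refine h.trans ?_
  by_cases hlm : lam = mu
  · subst hlm
    rw [if_pos rfl, if_pos ⟨Representation.Equiv.refl _⟩, mul_one]
  · rw [if_neg hlm, if_neg, mul_zero]
    rintro ⟨φ⟩
    exact hlm (shape_eq_of_equiv hm hl φ).symm

theorem character_one_pos {G V : Type*} [Monoid G] [AddCommGroup V] [Module ℂ V]
    [FiniteDimensional ℂ V] [Nontrivial V] (ρ : Representation ℂ G V) : 0 < ρ.character 1 := by
  rw [Representation.char_one]
  exact Nat.cast_pos.2 Module.finrank_pos

theorem spechtChar_one_pos {N : ℕ} {lam : YoungDiagram} (h : lam.card = N) :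
    0 < spechtChar N lam 1 := by
  obtain ⟨t⟩ := exists_tableau h
  have : Nontrivial (spechtSub N lam).toSubmodule :=
    ⟨⟨⟨_, polytabloid_mem t⟩, 0, fun h => polytabloid_ne_zero t (congrArg Subtype.val h)⟩⟩
  exact character_one_pos (G := Equiv.Perm (Fin N)) (V := (spechtSub N lam).toSubmodule)
    (spechtRep N lam)

noncomputable instance fintypeYoungDiagram (N : ℕ) :
    Fintype {lam : YoungDiagram // lam.card = N} := Fintype.ofFinite _

/-- A central positive definite function on a symmetric group is a nonnegative combination of
normalized irreducible characters. -/
theorem exists_eq_sum_spechtNormChar {N : ℕ} {φ : Equiv.Perm (Fin N) → ℂ}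
    (hc : IsCentralFun φ) (hp : IsPosDefFun φ) :
    ∃ p : {lam : YoungDiagram // lam.card = N} → ℝ, (∀ lam, 0 ≤ p lam) ∧
      ∀ g, φ g = ∑ lam, p lam * spechtNormChar N lam.1 g := by
  classical
  suffices h : ∃ p : {lam : YoungDiagram // lam.card = N} → ℂ, (∀ lam, 0 ≤ p lam) ∧
      ∀ g, φ g = ∑ lam, p lam * spechtNormChar N lam.1 g by
    obtain ⟨p, hp0, hpφ⟩ := h
    refine ⟨fun lam => (p lam).re, fun lam => (Complex.nonneg_iff.1 (hp0 lam)).1, fun g => ?_⟩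
    rw [hpφ]
    refine Finset.sum_congr rfl fun lam _ => ?_
    rw [← Complex.eq_re_of_ofReal_le (r := 0) (by simpa using hp0 lam)]
  -- The Fourier coefficient against `spechtChar`, times the dimension that compensates for the
  -- normalization.
  refine ⟨fun lam => ((Fintype.card (Equiv.Perm (Fin N)) : ℂ)⁻¹ *
    ∑ h, φ h * spechtChar N lam.1 h⁻¹) * spechtChar N lam.1 1, fun lam => ?_, fun g => ?_⟩
  · exact mul_nonneg (mul_nonneg (inv_nonneg.2 (Nat.cast_nonneg _))
      (hp.sum_mul_character_inv_nonneg _)) (spechtChar_one_pos lam.2).le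
  · rw [hc.eq_sum_of_orthonormal (fun lam : {lam : YoungDiagram // lam.card = N} =>
      spechtChar N lam.1) (fun lam => isCentralFun_spechtChar N _) ?_ ?_ g]
    · refine Finset.sum_congr rfl fun lam _ => ?_
      rw [spechtNormChar, mul_assoc _ (spechtChar N lam.1 1),
        mul_div_cancel₀ _ (spechtChar_one_pos lam.2).ne']
    · intro lam mu
      rw [spechtChar_orthonormal lam.2 mu.2]
      simp only [Subtype.ext_iff]
    · rw [← Nat.card_eq_fintype_card]
      exact card_conjClasses_perm_le N

end SpechtDecomposition

/-! ### The cone of central positive definite functions and its extreme rays. -/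

section CharacterCone

variable {G : Type*} [Group G]

theorem IsCentralFun.sum_smul {ι : Type*} {s : Finset ι} {φ : ι → G → ℂ} (p : ι → ℝ)
    (h : ∀ i ∈ s, IsCentralFun (φ i)) : IsCentralFun fun g => ∑ i ∈ s, (p i : ℂ) * φ i g :=
  fun g k => Finset.sum_congr rfl fun i hi => by rw [h i hi g k]

theorem IsPosDefFun.sum_smul {ι : Type*} {s : Finset ι} {φ : ι → G → ℂ} {p : ι → ℝ}
    (hp : ∀ i ∈ s, 0 ≤ p i) (h : ∀ i ∈ s, IsPosDefFun (φ i)) :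
    IsPosDefFun fun g => ∑ i ∈ s, (p i : ℂ) * φ i g := by
  intro m g
  have := Matrix.posSemidef_sum s (x := fun i =>
    (p i : ℂ) • (Matrix.of fun a b => φ i (g a * (g b)⁻¹))) fun i hi =>
      (h i hi m g).smul (Complex.zero_le_real.2 (hp i hi))
  convert this using 1
  ext a b
  simp [Matrix.sum_apply]

theorem IsPosDefFun.map_one_nonneg {φ : G → ℂ} (h : IsPosDefFun φ) : 0 ≤ φ 1 := by
  simpa using (h 1 fun _ => 1).diag_nonneg (i := 0)

/-- This is the nonnegativity of the 2 by 2 determinant for the points `g` and `1`; it provides the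
compactness for the limits below. -/
theorem IsPosDefFun.norm_le {φ : G → ℂ} (h : IsPosDefFun φ) (g : G) : ‖φ g‖ ≤ (φ 1).re := by
  have h1 := h 2 ![g, 1]
  have hherm := h1.isHermitian.apply 0 1
  have hdet := h1.det_nonneg
  rw [Matrix.det_fin_two] at hdet
  simp only [Matrix.of_apply, Matrix.cons_val_zero, Matrix.cons_val_one, inv_one, mul_one,
    mul_inv_cancel, one_mul] at hherm hdet
  have hone : φ 1 = ((φ 1).re : ℂ) :=
    Complex.eq_re_of_ofReal_le (r := 0) (by simpa using h.map_one_nonneg)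
  have hre : 0 ≤ (φ 1).re := (Complex.nonneg_iff.1 h.map_one_nonneg).1
  rw [← hherm, hone, Complex.star_def, mul_comm _ (φ g⁻¹),
    mul_comm (φ g⁻¹), ← Complex.normSq_eq_conj_mul_self, ← Complex.ofReal_mul,
    ← Complex.ofReal_sub, Complex.zero_le_real, Complex.normSq_eq_norm_sq] at hdet
  have hn : ‖φ g‖ = ‖φ g⁻¹‖ := by rw [← hherm, norm_star]
  rw [hn]
  nlinarith [norm_nonneg (φ g⁻¹)]

/-- A summand of an indecomposable character is proportional to it. -/
theorem IsIndecomposableCharacter.eq_mul_of_add {χ φ ψ : G → ℂ}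
    (hχ : IsIndecomposableCharacter χ) (hφc : IsCentralFun φ) (hφp : IsPosDefFun φ)
    (hψc : IsCentralFun ψ) (hψp : IsPosDefFun ψ) (h : χ = φ + ψ) (g : G) :
    φ g = φ 1 * χ g := by
  have hli : ¬ LinearIndependent ℂ ![φ, ψ] := fun hli =>
    hχ.indecomposable ⟨φ, ψ, hφc, hφp, hψc, hψp, hli, h⟩
  rw [LinearIndependent.pair_iff] at hli
  push Not at hli
  obtain ⟨s, t, hst, hne⟩ := hli
  have hψ : ∀ g, ψ g = χ g - φ g := fun g => by simp [h]
  -- Eliminating `ψ` from the dependence relation; the value at `1` then determines `t` and shows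
  -- that `s ≠ t`.
  have hst' : ∀ g, (s - t) * φ g + t * χ g = 0 := fun g => by
    have := congrFun hst g
    simp only [Pi.add_apply, Pi.smul_apply, smul_eq_mul, hψ, Pi.zero_apply] at this
    linear_combination this
  have h1 := hst' 1
  rw [hχ.map_one, mul_one] at h1
  have hs : s - t ≠ 0 := by
    intro hs
    rw [hs, zero_mul, zero_add] at h1
    exact hne (by rwa [h1, sub_zero] at hs) h1
  refine mul_left_cancel₀ hs ?_
  linear_combination hst' g - χ g * h1

theorem IsIndecomposableCharacter.eq_mul_of_sum {χ : G → ℂ} {ι : Type*} [Fintype ι]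
    {φ : ι → G → ℂ} (hχ : IsIndecomposableCharacter χ) (hc : ∀ i, IsCentralFun (φ i))
    (hp : ∀ i, IsPosDefFun (φ i)) (h : ∀ g, χ g = ∑ i, φ i g) (i : ι) (g : G) :
    φ i g = φ i 1 * χ g := by
  classical
  have hc' := IsCentralFun.sum_smul (s := Finset.univ.erase i) (fun _ => 1) fun j _ => hc j
  have hp' := IsPosDefFun.sum_smul (s := Finset.univ.erase i) (p := fun _ => 1)
    (fun _ _ => zero_le_one) fun j _ => hp j
  refine hχ.eq_mul_of_add (hc i) (hp i) hc' hp' ?_ g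
  ext g
  rw [h, ← Finset.add_sum_erase _ _ (Finset.mem_univ i)]
  simp

end CharacterCone

theorem isCentralFun_spechtNormChar (N : ℕ) (lam : YoungDiagram) :
    IsCentralFun (spechtNormChar N lam) := fun g h => by
  rw [spechtNormChar, spechtNormChar, isCentralFun_spechtChar]

theorem isPosDefFun_spechtNormChar {N : ℕ} {lam : YoungDiagram} (h : lam.card = N) :
    IsPosDefFun (spechtNormChar N lam) := by
  intro m g
  convert (isPosDefFun_spechtChar N lam m g).smul (inv_nonneg.2 (spechtChar_one_pos h).le) using 1
  ext i j
  simp [spechtNormChar, div_eq_inv_mul]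

theorem spechtNormChar_one {N : ℕ} {lam : YoungDiagram} (h : lam.card = N) :
    spechtNormChar N lam 1 = 1 := div_self (spechtChar_one_pos h).ne'

/-! ### Approximation of an indecomposable character by irreducible characters of high level. -/

section Limit

variable {n : ℕ → ℕ}

theorem toLimitSym_levelMap {k j : ℕ} (h : k ≤ j) (σ : Equiv.Perm (Fin (levelSize n k))) :
    toLimitSym n j (levelMap n k j h σ) = toLimitSym n k σ :=
  (DirectLimit.eq_of_le (F := fun k => Equiv.Perm (Fin (levelSize n k))) (f := levelMap n)
    ⟨k, σ⟩ j h).symm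

theorem eventually_mem_range_toLimitSym (g : LimitSym n) :
    ∀ᶠ k in atTop, g ∈ Set.range (toLimitSym n k) := by
  obtain ⟨k, σ, rfl⟩ := DirectLimit.exists_eq_mk (levelMap n) g
  exact eventually_atTop.2 ⟨k, fun j hj => ⟨_, toLimitSym_levelMap hj σ⟩⟩

theorem extendToLimitSym_apply (hn : ∀ i, 1 < n i) (k : ℕ)
    (φ : Equiv.Perm (Fin (levelSize n k)) → ℂ) (σ : Equiv.Perm (Fin (levelSize n k))) :
    extendToLimitSym n k φ (toLimitSym n k σ) = φ σ :=
  (toLimitSym_injective n hn k).extend_apply φ 0 σ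

/-- Bounded central positive definite functions on the symmetric groups have a limit along every
ultrafilter, and it is central and positive definite. -/
theorem exists_tendsto_extendToLimitSym (hn : ∀ i, 1 < n i) (U : Ultrafilter ℕ)
    (hU : (U : Filter ℕ) ≤ atTop) (Ψ : ∀ k, Equiv.Perm (Fin (levelSize n k)) → ℂ)
    (hc : ∀ k, IsCentralFun (Ψ k)) (hp : ∀ k, IsPosDefFun (Ψ k)) (h1 : ∀ k, (Ψ k 1).re ≤ 1) :
    ∃ φ : LimitSym n → ℂ, IsCentralFun φ ∧ IsPosDefFun φ ∧
      ∀ g, Tendsto (fun k => extendToLimitSym n k (Ψ k) g) U (𝓝 (φ g)) := by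
  have hev : ∀ g : LimitSym n, ∀ᶠ k in (U : Filter ℕ), g ∈ Set.range (toLimitSym n k) := fun g =>
    (eventually_mem_range_toLimitSym g).filter_mono hU
  have hlim : ∀ g : LimitSym n, ∃ z : ℂ,
      Tendsto (fun k => extendToLimitSym n k (Ψ k) g) U (𝓝 z) := by
    intro g
    have hmem : ∀ᶠ k in (U : Filter ℕ),
        extendToLimitSym n k (Ψ k) g ∈ Metric.closedBall (0 : ℂ) 1 := by
      filter_upwards [hev g] with k ⟨σ, hσ⟩
      rw [← hσ, extendToLimitSym_apply hn, mem_closedBall_zero_iff]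
      exact ((hp k).norm_le σ).trans (h1 k)
    obtain ⟨z, -, hz⟩ := (isCompact_closedBall (0 : ℂ) 1).ultrafilter_le_nhds'
      (U.map fun k => extendToLimitSym n k (Ψ k) g) hmem
    exact ⟨z, hz⟩
  choose φ hφ using hlim
  refine ⟨φ, fun g h => ?_, fun m g => ?_, hφ⟩
  · refine tendsto_nhds_unique_of_eventuallyEq (hφ _) (hφ _) ?_
    filter_upwards [hev g, hev h] with k ⟨σ, hσ⟩ ⟨τ, hτ⟩
    rw [← hσ, ← hτ, ← map_mul, ← map_mul, extendToLimitSym_apply hn, extendToLimitSym_apply hn,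
      hc k]
  -- Positivity of the extension by zero is claimed only for this finite family, once the level
  -- contains all its members.
  · have hpos : ∀ᶠ k in (U : Filter ℕ),
        (Matrix.of fun i j => extendToLimitSym n k (Ψ k) (g i * (g j)⁻¹)).PosSemidef := by
      filter_upwards [eventually_all.2 fun i => hev (g i)] with k hk
      choose σ hσ using hk
      convert hp k m σ using 4 with i j
      rw [← hσ i, ← hσ j, ← map_inv, ← map_mul, extendToLimitSym_apply hn]
    rw [Matrix.posSemidef_iff_dotProduct_mulVec]
    constructor
    · ext i j
      refine tendsto_nhds_unique_of_eventuallyEq ((hφ (g j * (g i)⁻¹)).star)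
        (hφ (g i * (g j)⁻¹)) ?_
      filter_upwards [hpos] with k hk
      exact hk.isHermitian.apply i j
    · intro x
      have ht : Tendsto (fun k => ∑ i, star (x i) *
            ∑ j, extendToLimitSym n k (Ψ k) (g i * (g j)⁻¹) * x j) U
          (𝓝 (∑ i, star (x i) * ∑ j, φ (g i * (g j)⁻¹) * x j)) :=
        tendsto_finsetSum _ fun i _ => (tendsto_finsetSum _ fun j _ =>
          (hφ _).mul_const _).const_mul _
      have := Complex.orderClosedTopology
      refine ge_of_tendsto ht ?_
      filter_upwards [hpos] with k hk
      exact (Matrix.posSemidef_iff_dotProduct_mulVec.1 hk).2 x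

/-- The larger of the absolute values of the real and imaginary parts is at least half the norm, and
a fourth root of unity rotates it to the positive real axis. This turns a bound on a norm into
finitely many linear inequalities, which survive weighted sums and limits. -/
theorem exists_unit_half_norm_le (z : ℂ) :
    ∃ i : Fin 4, ‖z‖ / 2 ≤ (![1, -1, Complex.I, -Complex.I] i * z).re := by
  have h := Complex.norm_le_abs_re_add_abs_im z
  rcases abs_cases z.re with ⟨h1, -⟩ | ⟨h1, -⟩ <;> rcases abs_cases z.im with ⟨h2, -⟩ | ⟨h2, -⟩ <;>
    rw [h1, h2] at h <;> by_contra! hcon <;>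
    (have a := hcon 0; have b := hcon 1; have c := hcon 2; have d := hcon 3
     simp at a b c d; linarith)

/-- Every neighbourhood of an indecomposable character contains normalized irreducible characters
of arbitrarily large levels. -/
theorem IsIndecomposableCharacter.exists_spechtNormChar_near (hn : ∀ i, 1 < n i)
    {χ : LimitSym n → ℂ} (hχ : IsIndecomposableCharacter χ) (F : Finset (LimitSym n)) {ε : ℝ}
    (hε : 0 < ε) (m : ℕ) :
    ∃ k ≥ m, ∃ lam : YoungDiagram, lam.card = levelSize n k ∧ ∀ g ∈ F,
      ‖extendToLimitSym n k (spechtNormChar (levelSize n k) lam) g - χ g‖ < ε := by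
  classical
  by_contra! hcon
  let u : Fin 4 → ℂ := ![1, -1, Complex.I, -Complex.I]
  -- A point of `F` is needed as the default class at levels below `m`, where nothing is required.
  have hF : F.Nonempty := by
    obtain ⟨t⟩ : Nonempty {lam : YoungDiagram // lam.card = levelSize n m} :=
      ⟨_, (Nat.Partition.indiscrete (levelSize n m)).card_toYoungDiagram⟩
    obtain ⟨g, hg, -⟩ := hcon m le_rfl t.1 t.2
    exact ⟨g, hg⟩
  obtain ⟨g₀, hg₀⟩ := hF
  have hclass : ∀ k (lam : {lam : YoungDiagram // lam.card = levelSize n k}),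
      ∃ j : F × Fin 4, m ≤ k → ε / 2 ≤ (u j.2 *
        (extendToLimitSym n k (spechtNormChar (levelSize n k) lam.1) j.1 - χ j.1)).re := by
    intro k lam
    by_cases hk : m ≤ k
    · obtain ⟨g, hg, hle⟩ := hcon k hk lam.1 lam.2
      obtain ⟨i, hi⟩ := exists_unit_half_norm_le
        (extendToLimitSym n k (spechtNormChar (levelSize n k) lam.1) g - χ g)
      exact ⟨(⟨g, hg⟩, i), fun _ => (by linarith : ε / 2 ≤ _).trans hi⟩
    · exact ⟨(⟨g₀, hg₀⟩, 0), fun h => absurd h hk⟩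
  choose c hc using hclass
  have hdec : ∀ k, ∃ p : {lam : YoungDiagram // lam.card = levelSize n k} → ℝ,
      (∀ lam, 0 ≤ p lam) ∧
      ∀ σ, χ (toLimitSym n k σ) = ∑ lam, p lam * spechtNormChar (levelSize n k) lam.1 σ := by
    intro k
    refine exists_eq_sum_spechtNormChar (φ := χ ∘ toLimitSym n k) (fun σ τ => ?_) fun l σ => ?_
    · simp only [Function.comp_apply, map_mul]
      exact hχ.central _ _
    · simpa using hχ.posDef l fun i => toLimitSym n k (σ i)
  choose p hp0 hp using hdec
  have hp1 : ∀ k, ∑ lam, p k lam = 1 := fun k => by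
    have := hp k 1
    rw [map_one, hχ.map_one] at this
    simp_rw [fun lam : {lam : YoungDiagram // lam.card = levelSize n k} =>
      spechtNormChar_one lam.2, mul_one] at this
    exact_mod_cast this.symm
  -- The part of `χ` at level `k` carried by the irreducible characters that deviate in the manner
  -- `j`.
  let Ψ : F × Fin 4 → ∀ k, Equiv.Perm (Fin (levelSize n k)) → ℂ := fun j k σ =>
    ∑ lam with c k lam = j, (p k lam : ℂ) * spechtNormChar (levelSize n k) lam.1 σ
  have hΨ1 : ∀ j k, Ψ j k 1 = ((∑ lam with c k lam = j, p k lam : ℝ) : ℂ) := fun j k => by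
    simp only [Ψ]
    rw [Complex.ofReal_sum]
    exact Finset.sum_congr rfl fun lam _ => by rw [spechtNormChar_one lam.2, mul_one]
  -- A nonprincipal ultrafilter gives limits for all classes and all group elements at once, without
  -- extracting subsequences.
  let U : Ultrafilter ℕ := hyperfilter ℕ
  have hU : (U : Filter ℕ) ≤ atTop := Nat.hyperfilter_le_atTop
  have hlim := fun j => exists_tendsto_extendToLimitSym hn U hU (Ψ j)
    (fun k => IsCentralFun.sum_smul _ fun lam _ => isCentralFun_spechtNormChar _ _)
    (fun k => IsPosDefFun.sum_smul (fun lam _ => hp0 k lam)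
      fun lam _ => isPosDefFun_spechtNormChar lam.2)
    (fun k => by
      rw [hΨ1, Complex.ofReal_re, ← hp1 k]
      exact Finset.sum_le_sum_of_subset_of_nonneg (Finset.filter_subset _ _)
        fun lam _ _ => hp0 k lam)
  choose φ hφc hφp hφ using hlim
  have hev : ∀ g : LimitSym n, ∀ᶠ k in (U : Filter ℕ), g ∈ Set.range (toLimitSym n k) := fun g =>
    (eventually_mem_range_toLimitSym g).filter_mono hU
  have hsum : ∀ g, χ g = ∑ j, φ j g := by
    intro g
    refine tendsto_nhds_unique_of_eventuallyEq tendsto_const_nhds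
      (tendsto_finsetSum Finset.univ fun j _ => hφ j g) ?_
    filter_upwards [hev g] with k ⟨σ, hσ⟩
    rw [← hσ, hp]
    simp_rw [extendToLimitSym_apply hn]
    exact (Finset.sum_fiberwise _ (c k) _).symm
  -- The deviation inequalities of class `j`, weighted by `p k` and summed, then passed to the
  -- limit.
  have hbound : ∀ j, ε / 2 * (φ j 1).re ≤ (u j.2 * (φ j j.1 - φ j 1 * χ j.1)).re := by
    intro j
    have ht1 : Tendsto (fun k => ε / 2 * (extendToLimitSym n k (Ψ j k) 1).re) U
        (𝓝 (ε / 2 * (φ j 1).re)) :=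
      ((Complex.continuous_re.tendsto _).comp (hφ j 1)).const_mul _
    have ht2 : Tendsto (fun k => (u j.2 * (extendToLimitSym n k (Ψ j k) j.1 -
          extendToLimitSym n k (Ψ j k) 1 * χ j.1)).re) U
        (𝓝 (u j.2 * (φ j j.1 - φ j 1 * χ j.1)).re) :=
      (Complex.continuous_re.tendsto _).comp
        (((hφ j j.1).sub ((hφ j 1).mul_const _)).const_mul _)
    refine le_of_tendsto_of_tendsto ht1 ht2 ?_
    filter_upwards [hev j.1, (eventually_ge_atTop m).filter_mono hU] with k ⟨σ, hσ⟩ hk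
    have hone : extendToLimitSym n k (Ψ j k) 1 = Ψ j k 1 := by
      rw [← map_one (toLimitSym n k), extendToLimitSym_apply hn]
    rw [hone, ← hσ, extendToLimitSym_apply hn, hΨ1, Complex.ofReal_re]
    simp only [Ψ]
    rw [Complex.ofReal_sum, Finset.sum_mul, ← Finset.sum_sub_distrib, Finset.mul_sum,
      Finset.mul_sum, Complex.re_sum]
    refine Finset.sum_le_sum fun lam hlam => ?_
    have h := hc k lam hk
    rw [(Finset.mem_filter.1 hlam).2, ← hσ, extendToLimitSym_apply hn] at h
    rw [← mul_sub, mul_left_comm, Complex.re_ofReal_mul, mul_comm]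
    exact mul_le_mul_of_nonneg_left h (hp0 k lam)
  have hzero : ∀ j, (φ j 1).re ≤ 0 := by
    intro j
    have h := hbound j
    -- Proportionality of `φ j` to `χ` makes the right-hand side of `hbound` zero.
    rw [hχ.eq_mul_of_sum hφc hφp hsum j j.1, sub_self, mul_zero, Complex.zero_re] at h
    by_contra! hpos
    nlinarith
  have h1 := congrArg Complex.re (hsum 1)
  rw [hχ.map_one, Complex.one_re, Complex.re_sum] at h1
  have := Finset.sum_nonpos fun j (_ : j ∈ Finset.univ) => hzero j
  linarith

end Limit

/-! ### Diagonal choice of the approximating sequence. -/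

theorem mainTheorem4 (n : ℕ → ℕ) (hn : ∀ i, 1 < n i)
    (χ : LimitSym n → ℂ) (hχ : IsIndecomposableCharacter χ) :
    ∃ (k : ℕ → ℕ) (lam : ℕ → YoungDiagram),
      StrictMono k ∧
      (∀ l, (lam l).card = levelSize n (k l)) ∧
      (∀ l, Representation.IsIrreducible (k := ℂ)
        (V := (spechtSub (levelSize n (k l)) (lam l)).toSubmodule)
        (spechtRep (levelSize n (k l)) (lam l))) ∧
      ∀ g : LimitSym n,
        Tendsto
          (fun l => extendToLimitSym n (k l) (spechtNormChar (levelSize n (k l)) (lam l)) g)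
          atTop (𝓝 (χ g)) := by
  classical
  -- The `l`-th term approximates `χ` within `1 / (l + 1)` on the whole image of the `l`-th finite
  -- group; each `g` lies in that image for all large `l`.
  obtain ⟨k, hk, h⟩ := extraction_forall_of_frequently
    (P := fun l k => ∃ lam : YoungDiagram, lam.card = levelSize n k ∧
      ∀ g ∈ Finset.univ.image (toLimitSym n l),
        ‖extendToLimitSym n k (spechtNormChar (levelSize n k) lam) g - χ g‖ < 1 / ((l : ℝ) + 1))
    fun l => frequently_atTop.2 fun m =>
      hχ.exists_spechtNormChar_near hn _ Nat.one_div_pos_of_nat m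
  choose lam hcard hnear using h
  refine ⟨k, lam, hk, hcard, fun l => spechtRep_isIrreducible (hcard l), fun g => ?_⟩
  rw [tendsto_iff_norm_sub_tendsto_zero]
  refine squeeze_zero' (Eventually.of_forall fun _ => norm_nonneg _) ?_
    tendsto_one_div_add_atTop_nhds_zero_nat
  filter_upwards [eventually_mem_range_toLimitSym g] with l ⟨σ, hσ⟩
  exact (hnear l g (Finset.mem_image.2 ⟨σ, Finset.mem_univ σ, hσ⟩)).le
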